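/- Write $(a)_k=a(a+1)\cdots(a+k-1)$ for the rising factorial. For every integer $k\ge 1$, $$\sum_{n\ge 0}\frac{\left[\frac{1}{4^n}\binom{2n}{n}\right]^3}{(n+1)_k\left(\frac12-n\right)_k}=\frac{\Gamma\left(\frac14\right)^2}{2\pi\sqrt2}\cdot\frac{\Gamma\left(k+\frac14\right)}{\Gamma\left(k+\frac12\right)^2\,\Gamma\left(k+\frac34\right)},\qquad \sum_{n\ge 0}\frac{\left[\frac{1}{4^n}\binom{2n}{n}\right]^2}{(n+1)_k\left(\frac12-n\right)_k}=\frac{2^{8k-3}\,\Gamma(k)^2}{\pi\,\Gamma(4k)},$$ both series being convergent. Additionally, let $p(x)\in\mathbb{Q}[x]$ be a nonzero polynomial of even degree, all of whose complex roots are simple and belong to $\left\{\ldots,-3,-2,-1,\frac12,\frac32,\frac52,\ldots\right\}$, and such that $p(x)=p\left(-\frac12-x\right)$. Then $$\sum_{n\ge 0}\frac{1}{p(n)}\left[\frac{1}{4^n}\binom{2n}{n}\right]^3$$ converges to a rational multiple of $\frac{\Gamma(1/4)^4}{8\pi^3}$, and, if $p$ is not constant, $$\sum_{n\ge 0}\frac{1}{p(n)}\left[\frac{1}{4^n}\binom{2n}{n}\right]^2$$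 converges to a rational multiple of $\frac1\pi$. -/

import Mathlib

/-- The normalized central binomial coefficient `C(2n, n) / 4 ^ n`. -/
noncomputable def centralRatio (n : ℕ) : ℝ := (Nat.choose (2 * n) n : ℝ) / 4 ^ n

/-- The rising factorial `(a)_k = a (a + 1) ⋯ (a + k - 1)`. -/
noncomputable def risingFactorial (a : ℝ) (k : ℕ) : ℝ := (ascPochhammer ℝ k).eval a

/-- The set `{…, -3, -2, -1, 1/2, 3/2, 5/2, …}`. -/
def admissibleRoots : Set ℂ :=
  {z | (∃ m : ℕ, z = -((m : ℂ) + 1)) ∨ (∃ m : ℕ, z = (m : ℂ) + 1 / 2)}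

/-- Nonzero polynomials of even degree, all of whose complex roots are simple and lie in
`admissibleRoots`, and with `p(x) = p(-1/2 - x)`. -/
structure IsAdmissible (p : Polynomial ℚ) : Prop where
  ne_zero : p ≠ 0
  even_degree : Even p.natDegree
  simple_roots : (p.aroots ℂ).Nodup
  roots_mem : ∀ z ∈ p.aroots ℂ, z ∈ admissibleRoots
  symmetric : p.comp (Polynomial.C (-1 / 2) - Polynomial.X) = p

/-! Let c_n be the central ratio and P_k(n) = (n+1)_k (1/2-n)_k. The term ratio of c_n^3 / P_k(n) is
that of a well-poised ₃F₂(1) (Dixon's sum at a = 1/2), and that of c_n^2 / P_k(n) is that of a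
₂F₁(1) (Gauss's sum at c = k+1). So the two closed forms are Dixon's and Gauss's theorems,
simplified by the duplication and reflection formulas for Γ.

Both summations are proved in the same way. Shifting a parameter (a to a+2, respectively c to c+1)
multiplies the sum by an explicit rational factor, because the difference of terms telescopes
through a certificate (`dixonTerm_sub`, `gaussTerm_sub`). As the parameter tends to infinity the sum
tends to its n = 0 term, which is 1. The sum is therefore an infinite product of rational factors,
which Euler's limit turns into Gamma values (`hasSum_of_telescoping_recurrence`,
`tendsto_prod_ratio_Gamma`).

For the rationality statements, put t = n(n+1/2), which is invariant under n ↦ -1/2-n. Then P_k(n)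
is the product of (m+1)(m+1/2) - t over m < k, and an admissible p is a constant times a product of
distinct such factors. Hence 1/p = N(t)/P_M with N a rational polynomial, and repeated division
expands this as a rational combination of the 1/P_k, whose sums are known rational multiples of the
constant. -/

/-! ### Telescoping recurrences and infinite products -/

-- Summing `hFG` over n kills the right side, so the sums satisfy S_j = R_j S_{j+1}. Domination by
-- `B` gives S_j → 1, and iterating leaves S_0 as the infinite product of the R_j.
open Filter Topology Finset in
theorem hasSum_of_telescoping_recurrence {F G : ℕ → ℕ → ℝ} {R B : ℕ → ℝ} {L : ℝ}
    (hB : Summable B) (hFB : ∀ j n, |F j n| ≤ B n)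
    (hlim : ∀ n, Tendsto (fun j => F j n) atTop (𝓝 (if n = 0 then 1 else 0)))
    (hFG : ∀ j n, F j n - R j * F (j + 1) n = G j (n + 1) - G j n)
    (hG0 : ∀ j, G j 0 = 0) (hG : ∀ j, Tendsto (G j) atTop (𝓝 0))
    (hR : Tendsto (fun N => ∏ j ∈ range N, R j) atTop (𝓝 L)) :
    HasSum (F 0) L := by
  have hs : ∀ j, Summable (F j) := fun j =>
    Summable.of_norm_bounded hB (fun n => by simpa using hFB j n)
  have hstep : ∀ j, ∑' n, F j n = R j * ∑' n, F (j + 1) n := by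
    intro j
    have h1 := ((hs j).hasSum.sub ((hs (j + 1)).hasSum.mul_left (R j))).tendsto_sum_nat
    have h2 : (fun N => ∑ n ∈ range N, (F j n - R j * F (j + 1) n)) = G j := by
      funext N
      rw [sum_congr rfl (fun n _ => hFG j n), sum_range_sub, hG0, sub_zero]
    rw [h2] at h1
    exact sub_eq_zero.mp (tendsto_nhds_unique h1 (hG j))
  have hprod : ∀ N, ∑' n, F 0 n = (∏ j ∈ range N, R j) * ∑' n, F N n := by
    intro N
    induction N with
    | zero => simp
    | succ N ih => rw [ih, hstep N, prod_range_succ]; ring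
  have h1 : Tendsto (fun j => ∑' n, F j n) atTop (𝓝 (∑' n : ℕ, if n = 0 then 1 else 0)) :=
    tendsto_tsum_of_dominated_convergence hB hlim
      (Eventually.of_forall fun j n => by simpa using hFB j n)
  rw [tsum_ite_eq] at h1
  have h2 := hR.mul h1
  simp only [← hprod, mul_one] at h2
  have h3 := tendsto_nhds_unique tendsto_const_nhds h2
  exact h3 ▸ (hs 0).hasSum

open Filter Topology Finset in
/-- The infinite product of a balanced rational function, as a quotient of Gamma values. -/
theorem tendsto_prod_ratio_Gamma {ι : Type*} [Fintype ι] (x y : ι → ℝ)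
    (hx : ∀ i, 0 < x i) (hy : ∀ i, 0 < y i) (hxy : ∑ i, x i = ∑ i, y i) :
    Tendsto (fun N : ℕ => ∏ j ∈ range N, ∏ i, ((x i + j) / (y i + j))) atTop
      (𝓝 (∏ i, (Real.Gamma (y i) / Real.Gamma (x i)))) := by
  -- `Real.GammaSeq` at n has n + 1 factors in its denominator.
  rw [← tendsto_add_atTop_iff_nat 1]
  have h : Tendsto (fun n : ℕ => ∏ i, (Real.GammaSeq (y i) n / Real.GammaSeq (x i) n)) atTop
      (𝓝 (∏ i, (Real.Gamma (y i) / Real.Gamma (x i)))) :=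
    tendsto_finsetProd _ fun i _ => (Real.GammaSeq_tendsto_Gamma _).div
      (Real.GammaSeq_tendsto_Gamma _) (Real.Gamma_pos_of_pos (hx i)).ne'
  refine h.congr' ?_
  filter_upwards [eventually_gt_atTop 0] with n hn
  have hn' : (0 : ℝ) < n := by exact_mod_cast hn
  have hpow : ∀ z : ι → ℝ, ∏ i, (n : ℝ) ^ z i = (n : ℝ) ^ ∑ i, z i := fun z =>
    (Real.rpow_sum_of_pos hn' z univ).symm
  have hterm : ∀ i, Real.GammaSeq (y i) n / Real.GammaSeq (x i) n =
      ((n : ℝ) ^ y i / (n : ℝ) ^ x i) * ∏ j ∈ range (n + 1), ((x i + j) / (y i + j)) := by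
    intro i
    have h1 : ∏ j ∈ range (n + 1), (x i + j) ≠ 0 :=
      prod_ne_zero_iff.mpr fun j _ => by have := hx i; positivity
    have h2 : ∏ j ∈ range (n + 1), (y i + j) ≠ 0 :=
      prod_ne_zero_iff.mpr fun j _ => by have := hy i; positivity
    have h3 : (n.factorial : ℝ) ≠ 0 := by positivity
    have h4 := (Real.rpow_pos_of_pos hn' (x i)).ne'
    rw [Real.GammaSeq, Real.GammaSeq, prod_div_distrib]
    field_simp
  simp only [hterm]
  -- The powers of n cancel because the parameters are balanced.
  rw [prod_mul_distrib, prod_div_distrib, hpow, hpow, hxy,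
    div_self (Real.rpow_pos_of_pos hn' _).ne', one_mul, Finset.prod_comm]

/-! ### Size of the central ratio -/

theorem centralRatio_zero : centralRatio 0 = 1 := by simp [centralRatio]

theorem centralRatio_succ (n : ℕ) :
    centralRatio (n + 1) = centralRatio n * ((1 / 2 + n) / (n + 1)) := by
  have h := Nat.succ_mul_centralBinom_succ n
  rw [Nat.centralBinom_eq_two_mul_choose, Nat.centralBinom_eq_two_mul_choose] at h
  have h' : ((n : ℝ) + 1) * (Nat.choose (2 * (n + 1)) (n + 1) : ℝ)
      = 2 * (2 * n + 1) * (Nat.choose (2 * n) n : ℝ) := by exact_mod_cast h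
  unfold centralRatio
  have h0 : (n : ℝ) + 1 ≠ 0 := by positivity
  rw [div_mul_div_comm, div_eq_div_iff (by positivity) (by positivity), pow_succ]
  linear_combination (4 ^ n : ℝ) * h'

theorem centralRatio_pos (n : ℕ) : 0 < centralRatio n := by
  unfold centralRatio
  have := Nat.centralBinom_pos n
  rw [Nat.centralBinom_eq_two_mul_choose] at this
  positivity

theorem centralRatio_sq_le (n : ℕ) : centralRatio n ^ 2 ≤ 1 / ((n : ℝ) + 1) := by
  induction n with
  | zero => simp [centralRatio_zero]
  | succ n ih =>
    rw [centralRatio_succ, mul_pow]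
    calc _ ≤ 1 / ((n : ℝ) + 1) * ((1 / 2 + n) / (n + 1)) ^ 2 := by gcongr
      _ ≤ _ := by
        push_cast
        rw [div_pow, div_mul_div_comm, div_le_div_iff₀ (by positivity) (by positivity)]
        nlinarith [(Nat.cast_nonneg n : (0 : ℝ) ≤ n)]

theorem centralRatio_le_rpow (n : ℕ) :
    centralRatio n ≤ ((n : ℝ) + 1) ^ (-(1 / 2) : ℝ) := by
  rw [Real.rpow_neg (by positivity), ← Real.sqrt_eq_rpow, ← one_div]
  refine (Real.le_sqrt' (centralRatio_pos n)).mpr (centralRatio_sq_le n) |>.trans_eq ?_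
  rw [Real.sqrt_div zero_le_one, Real.sqrt_one]

open Filter Topology in
theorem tendsto_centralRatio : Tendsto centralRatio atTop (𝓝 0) := by
  refine squeeze_zero (fun n => (centralRatio_pos n).le) centralRatio_le_rpow ?_
  exact (tendsto_rpow_neg_atTop (by norm_num : (0 : ℝ) < 1 / 2)).comp
    (tendsto_atTop_add_const_right _ _ tendsto_natCast_atTop_atTop)

/-- The terms are O(n^(-3/2)). These sequences are the dominating series for both hypergeometric
families. -/
theorem summable_centralRatio_mul {x : ℝ} (hx : 1 / 2 ≤ x) :
    Summable fun n : ℕ => centralRatio n * (x / (x + n)) := by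
  have h : Summable fun n : ℕ => (2 * x) * ((n : ℝ) + 1) ^ (-(3 / 2) : ℝ) := by
    refine Summable.mul_left _ ?_
    have := (summable_nat_add_iff 1).mpr
      (Real.summable_nat_rpow.mpr (by norm_num : (-(3 / 2) : ℝ) < -1))
    simpa using this
  refine Summable.of_nonneg_of_le (fun n => ?_) (fun n => ?_) h
  · have := centralRatio_pos n
    positivity
  · have h1 : x / (x + n) ≤ 2 * x * ((n : ℝ) + 1) ^ (-1 : ℝ) := by
      rw [Real.rpow_neg_one, ← div_eq_mul_inv, div_le_div_iff₀ (by positivity) (by positivity)]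
      nlinarith [(Nat.cast_nonneg n : (0 : ℝ) ≤ n),
        mul_nonneg (sub_nonneg.mpr hx) (Nat.cast_nonneg n : (0 : ℝ) ≤ n)]
    calc _ ≤ ((n : ℝ) + 1) ^ (-(1 / 2) : ℝ) * (2 * x * ((n : ℝ) + 1) ^ (-1 : ℝ)) := by
          gcongr
          exact centralRatio_le_rpow n
      _ = _ := by
          rw [mul_left_comm, ← Real.rpow_add (by positivity)]
          norm_num

/-! ### Hypergeometric terms and uniform bounds -/

/-- The terms of `₃F₂(a, 1/2, 1/2 - k; a + 1/2, a + k + 1/2; 1)`. -/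
noncomputable def dixonTerm (k a : ℝ) (n : ℕ) : ℝ :=
  ∏ i ∈ Finset.range n, ((a + i) * (1 / 2 + i) * (1 / 2 - k + i)) /
    ((a + 1 / 2 + i) * (a + k + 1 / 2 + i) * (i + 1))

/-- The terms of `₂F₁(1/2, 1/2 - k; c; 1)`. -/
noncomputable def gaussTerm (k c : ℝ) (n : ℕ) : ℝ :=
  ∏ i ∈ Finset.range n, ((1 / 2 + i) * (1 / 2 - k + i)) / ((c + i) * (i + 1))

/-- The factors (1/2+i)/(i+1) multiply up to `centralRatio n`, and the factors (x+i)/(x+i+1)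
telescope to x/(x+n). -/
theorem abs_prod_range_le_centralRatio_mul {f : ℕ → ℝ} {x : ℝ} (hx : 0 < x)
    (hf : ∀ i : ℕ, |f i| ≤ (1 / 2 + i) / (i + 1) * ((x + i) / (x + i + 1))) (n : ℕ) :
    |∏ i ∈ Finset.range n, f i| ≤ centralRatio n * (x / (x + n)) := by
  induction n with
  | zero => simp [centralRatio_zero, hx.ne']
  | succ n ih =>
    rw [Finset.prod_range_succ, abs_mul, centralRatio_succ]
    have := centralRatio_pos n
    calc _ ≤ centralRatio n * (x / (x + n)) *
          ((1 / 2 + n) / (n + 1) * ((x + n) / (x + n + 1))) := by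
          gcongr
          exact hf n
      _ = _ := by
          push_cast
          rw [← add_assoc]
          field_simp

/-- The bound is independent of a, so it dominates all the shifts of a at once. -/
theorem abs_dixonTerm_le {k a : ℝ} (hk : 0 ≤ k) (ha : 1 / 2 ≤ a) (n : ℕ) :
    |dixonTerm k a n| ≤ centralRatio n * ((k + 1 / 2) / (k + 1 / 2 + n)) := by
  refine abs_prod_range_le_centralRatio_mul (by positivity) (fun i => ?_) n
  have hi : (0 : ℝ) ≤ i := Nat.cast_nonneg i
  have h1 : |1 / 2 - k + (i : ℝ)| ≤ k + 1 / 2 + i := abs_le.mpr ⟨by linarith, by linarith⟩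
  rw [abs_div, abs_mul, abs_of_nonneg (by positivity : 0 ≤ (a + i) * (1 / 2 + i)),
    abs_of_nonneg (by positivity : 0 ≤ (a + 1 / 2 + i) * (a + k + 1 / 2 + i) * ((i : ℝ) + 1))]
  have h2 : (a + i) / ((a + 1 / 2 + i) * (a + k + 1 / 2 + i)) ≤ 1 / (k + 1 / 2 + i + 1) := by
    rw [div_le_div_iff₀ (by positivity) (by positivity)]
    nlinarith [mul_nonneg (sub_nonneg.mpr ha) (by positivity : 0 ≤ a + i)]
  calc _ ≤ (a + i) * (1 / 2 + i) * (k + 1 / 2 + i) /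
        ((a + 1 / 2 + i) * (a + k + 1 / 2 + i) * (i + 1)) := by gcongr
    _ = (1 / 2 + i) / (i + 1) * ((k + 1 / 2 + i) *
        ((a + i) / ((a + 1 / 2 + i) * (a + k + 1 / 2 + i)))) := by field_simp
    _ ≤ (1 / 2 + i) / (i + 1) * ((k + 1 / 2 + i) * (1 / (k + 1 / 2 + i + 1))) := by gcongr
    _ = _ := by rw [mul_one_div]

theorem abs_gaussTerm_le {k c : ℝ} (hk : 1 ≤ k) (hc : k + 1 ≤ c) (n : ℕ) :
    |gaussTerm k c n| ≤ centralRatio n * ((k - 1 / 2) / (k - 1 / 2 + n)) := by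
  refine abs_prod_range_le_centralRatio_mul (by linarith) (fun i => ?_) n
  have hi : (0 : ℝ) ≤ i := Nat.cast_nonneg i
  have h1 : |1 / 2 - k + (i : ℝ)| ≤ k - 1 / 2 + i := abs_le.mpr ⟨by linarith, by linarith⟩
  have hc0 : 0 < c + i := by linarith
  rw [abs_div, abs_mul, abs_of_nonneg (by positivity : 0 ≤ (1 / 2 + (i : ℝ))),
    abs_of_nonneg (by positivity : 0 ≤ (c + i) * ((i : ℝ) + 1)),
    mul_comm (c + (i : ℝ)), mul_div_mul_comm]
  have h2 : k - 1 / 2 + i + 1 ≤ c + i := by linarith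
  have h3 : 0 < k - 1 / 2 + i + 1 := by linarith
  have h4 : 0 ≤ k - 1 / 2 + (i : ℝ) := by linarith
  refine mul_le_mul_of_nonneg_left ?_ (by positivity)
  exact div_le_div₀ h4 h1 h3 h2

/-! ### Contiguous relations and certificates -/

theorem dixonTerm_succ (k a : ℝ) (n : ℕ) : dixonTerm k a (n + 1) = dixonTerm k a n *
    (((a + n) * (1 / 2 + n) * (1 / 2 - k + n)) /
      ((a + 1 / 2 + n) * (a + k + 1 / 2 + n) * (n + 1))) :=
  Finset.prod_range_succ _ _

theorem gaussTerm_succ (k c : ℝ) (n : ℕ) : gaussTerm k c (n + 1) = gaussTerm k c n *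
    (((1 / 2 + n) * (1 / 2 - k + n)) / ((c + n) * (n + 1))) :=
  Finset.prod_range_succ _ _

theorem gaussTerm_add_one {k c : ℝ} (hc : 0 < c) (n : ℕ) :
    gaussTerm k (c + 1) n = gaussTerm k c n * (c / (c + n)) := by
  induction n with
  | zero => simp [gaussTerm, hc.ne']
  | succ n ih =>
    rw [gaussTerm_succ, gaussTerm_succ, ih]
    push_cast
    have : c + 1 + n ≠ 0 := by positivity
    field_simp
    ring

theorem dixonTerm_add_two {k a : ℝ} (hk : 0 ≤ k) (ha : 0 < a) (n : ℕ) :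
    dixonTerm k (a + 2) n = dixonTerm k a n *
      (((a + n) * (a + n + 1) * (a + 1 / 2) * (a + 3 / 2) * (a + k + 1 / 2) * (a + k + 3 / 2)) /
      (a * (a + 1) * (a + 1 / 2 + n) * (a + 3 / 2 + n) * (a + k + 1 / 2 + n) *
        (a + k + 3 / 2 + n))) := by
  induction n with
  | zero =>
    simp only [dixonTerm, Finset.prod_range_zero, Nat.cast_zero, add_zero, one_mul]
    rw [eq_comm, div_eq_one_iff_eq (by positivity)]
  | succ n ih =>
    rw [dixonTerm_succ, dixonTerm_succ, ih, mul_assoc, mul_assoc (dixonTerm k a n)]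
    congr 1
    push_cast
    have e1 : a + 2 + (n : ℝ) = a + (n + 1) + 1 := by ring
    have e2 : a + 2 + 1 / 2 + (n : ℝ) = a + 3 / 2 + (n + 1) := by ring
    have e3 : a + 2 + k + 1 / 2 + (n : ℝ) = a + k + 3 / 2 + (n + 1) := by ring
    have e4 : a + 1 / 2 + ((n : ℝ) + 1) = a + 3 / 2 + n := by ring
    have e5 : a + k + 1 / 2 + ((n : ℝ) + 1) = a + k + 3 / 2 + n := by ring
    have e6 : a + (n : ℝ) + 1 = a + (n + 1) := by ring
    have h1 : a + 3 / 2 + ((n : ℝ) + 1) ≠ 0 := by positivity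
    have h2 : a + k + 3 / 2 + ((n : ℝ) + 1) ≠ 0 := by positivity
    have h3 : a + 3 / 2 + (n : ℝ) ≠ 0 := by positivity
    have h4 : a + k + 3 / 2 + (n : ℝ) ≠ 0 := by positivity
    have h5 : a + 1 / 2 + (n : ℝ) ≠ 0 := by positivity
    have h6 : a + k + 1 / 2 + (n : ℝ) ≠ 0 := by positivity
    have h7 : (n : ℝ) + 1 ≠ 0 := by positivity
    have h8 : a + 1 ≠ 0 := by positivity
    rw [e1, e2, e3, e4, e5, e6]
    generalize a + 3 / 2 + ((n : ℝ) + 1) = y₂ at *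
    generalize a + k + 3 / 2 + ((n : ℝ) + 1) = z₂ at *
    generalize a + 3 / 2 + (n : ℝ) = y₁ at *
    generalize a + k + 3 / 2 + (n : ℝ) = z₁ at *
    generalize a + 1 / 2 + (n : ℝ) = y at *
    generalize a + k + 1 / 2 + (n : ℝ) = z at *
    field_simp

/-- A telescoping certificate for the shift `c ↦ c + 1` in Gauss's summation. -/
noncomputable def gaussCertificate (k c : ℝ) (n : ℕ) : ℝ :=
  -(n / (c + k - 1)) * gaussTerm k c n

/-- The coefficient is the quotient of Gauss's values at c and c+1. Divided by `gaussTerm k c n`,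
the claim is an identity of rational functions. -/
theorem gaussTerm_sub {k c : ℝ} (hk : 1 ≤ k) (hc : 0 < c) (n : ℕ) :
    gaussTerm k c n - (c - 1 / 2) * (c + k - 1 / 2) / (c * (c + k - 1)) * gaussTerm k (c + 1) n =
      gaussCertificate k c (n + 1) - gaussCertificate k c n := by
  rw [gaussCertificate, gaussCertificate, gaussTerm_add_one hc, gaussTerm_succ]
  have h1 : c + k - 1 ≠ 0 := by linarith
  have h2 : c + n ≠ 0 := by positivity
  push_cast
  field_simp
  ring

/-- A telescoping certificate for the shift `a ↦ a + 2` in Dixon's summation. -/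
noncomputable def dixonCertificate (k a : ℝ) (n : ℕ) : ℝ :=
  -(n * (n ^ 2 + (3 * a + 1 + 2 * k) * n +
      (2 * a ^ 2 + a - 1 / 4 + ((2 * a ^ 2 - a / 2 - 1 / 2) * k - k ^ 2) / a)) /
    ((a + 2 * k) * (a + 1 / 2 + n) * (a + k + 1 / 2 + n))) * dixonTerm k a n

/-- Dixon's value involves Γ at arguments containing a/2, so moving a by two makes the quotient of
values rational in a; that quotient is the coefficient here. -/
theorem dixonTerm_sub {k a : ℝ} (hk : 0 ≤ k) (ha : 0 < a) (n : ℕ) :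
    dixonTerm k a n -
      4 * (1 + a) * (a + k) * (1 + a + k) * (a / 2 + 1 / 2) * (a / 2 + 1 / 2 + k) /
        ((a + 2 * k) * (a + 1 / 2) * (a + 3 / 2) * (a + k + 1 / 2) * (a + k + 3 / 2)) *
        dixonTerm k (a + 2) n =
      dixonCertificate k a (n + 1) - dixonCertificate k a n := by
  rw [dixonCertificate, dixonCertificate, dixonTerm_add_two hk ha, dixonTerm_succ]
  have h1 : a + 2 * k ≠ 0 := by positivity
  have h2 : a + 1 / 2 + n ≠ 0 := by positivity
  have h3 : a + 3 / 2 + n ≠ 0 := by positivity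
  have h4 : a + k + 1 / 2 + n ≠ 0 := by positivity
  have h5 : a + k + 3 / 2 + n ≠ 0 := by positivity
  have h6 : a + 1 / 2 + (n + 1) = a + 3 / 2 + n := by ring
  have h7 : a + k + 1 / 2 + (n + 1) = a + k + 3 / 2 + n := by ring
  have h8 : a + 1 / 2 ≠ 0 := by positivity
  have h9 : a + 3 / 2 ≠ 0 := by positivity
  have h10 : a + k + 1 / 2 ≠ 0 := by positivity
  have h11 : a + k + 3 / 2 ≠ 0 := by positivity
  have h12 : (n : ℝ) + 1 ≠ 0 := by positivity
  push_cast
  rw [h6, h7]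
  generalize dixonTerm k a n = t
  -- The claim divided by the common factor `dixonTerm k a n`.
  have key : (1 : ℝ) -
      4 * (1 + a) * (a + k) * (1 + a + k) * (a / 2 + 1 / 2) * (a / 2 + 1 / 2 + k) /
        ((a + 2 * k) * (a + 1 / 2) * (a + 3 / 2) * (a + k + 1 / 2) * (a + k + 3 / 2)) *
      (((a + n) * (a + n + 1) * (a + 1 / 2) * (a + 3 / 2) * (a + k + 1 / 2) * (a + k + 3 / 2)) /
      (a * (a + 1) * (a + 1 / 2 + n) * (a + 3 / 2 + n) * (a + k + 1 / 2 + n) *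
        (a + k + 3 / 2 + n))) =
      -((n + 1) * ((n + 1) ^ 2 + (3 * a + 1 + 2 * k) * (n + 1) +
      (2 * a ^ 2 + a - 1 / 4 + ((2 * a ^ 2 - a / 2 - 1 / 2) * k - k ^ 2) / a)) /
    ((a + 2 * k) * (a + 3 / 2 + n) * (a + k + 3 / 2 + n))) *
    (((a + n) * (1 / 2 + n) * (1 / 2 - k + n)) /
      ((a + 1 / 2 + n) * (a + k + 1 / 2 + n) * (n + 1)))
    + (n * (n ^ 2 + (3 * a + 1 + 2 * k) * n +
      (2 * a ^ 2 + a - 1 / 4 + ((2 * a ^ 2 - a / 2 - 1 / 2) * k - k ^ 2) / a)) /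
    ((a + 2 * k) * (a + 1 / 2 + n) * (a + k + 1 / 2 + n))) := by
    generalize (n : ℝ) = x at *
    generalize ha1 : a + 1 / 2 + x = u at *
    generalize ha2 : a + 3 / 2 + x = u' at *
    generalize ha3 : a + k + 1 / 2 + x = v at *
    generalize ha4 : a + k + 3 / 2 + x = v' at *
    field_simp
    subst ha1 ha2 ha3 ha4
    ring
  linear_combination t * key

/-! ### Limits of certificates and terms -/

open Filter Topology

theorem tendsto_gaussCertificate {k c : ℝ} (hk : 1 ≤ k) (hc : k + 1 ≤ c) :
    Tendsto (gaussCertificate k c) atTop (𝓝 0) := by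
  have hck : 0 < c + k - 1 := by linarith
  have h := tendsto_centralRatio.const_mul ((k - 1 / 2) / (c + k - 1))
  rw [mul_zero] at h
  refine squeeze_zero_norm (fun n => ?_) h
  have hkn : 0 < k - 1 / 2 + n := by
    have : (0 : ℝ) ≤ n := Nat.cast_nonneg n
    linarith
  have hk' : 0 ≤ k - 1 / 2 := by linarith
  have hc0 := (centralRatio_pos n).le
  rw [gaussCertificate, Real.norm_eq_abs, abs_mul, abs_neg, abs_of_nonneg (by positivity)]
  calc _ ≤ n / (c + k - 1) * (centralRatio n * ((k - 1 / 2) / (k - 1 / 2 + n))) := by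
        gcongr
        exact abs_gaussTerm_le hk hc n
    _ = (k - 1 / 2) / (c + k - 1) * centralRatio n * (n / (k - 1 / 2 + n)) := by ring
    _ ≤ _ := mul_le_of_le_one_right (by positivity) ((div_le_one hkn).mpr (by linarith))

/-- The rational factor grows at most linearly in n, while the term is at most `centralRatio n`
times O(1/n); the product is O(`centralRatio n`). -/
theorem tendsto_dixonCertificate {k a : ℝ} (hk : 0 ≤ k) (ha : 1 / 2 ≤ a) :
    Tendsto (dixonCertificate k a) atTop (𝓝 0) := by
  set p := 3 * a + 1 + 2 * k with hp
  set q := 2 * a ^ 2 + a - 1 / 4 + ((2 * a ^ 2 - a / 2 - 1 / 2) * k - k ^ 2) / a with hq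
  have h := tendsto_centralRatio.const_mul ((1 + |p| + |q|) * (k + 1 / 2) / (a + 2 * k))
  rw [mul_zero] at h
  refine squeeze_zero_norm (fun n => ?_) h
  have hn : (0 : ℝ) ≤ n := Nat.cast_nonneg n
  have hc0 := (centralRatio_pos n).le
  have hnum : |(n : ℝ) ^ 2 + p * n + q| ≤
      (1 + |p| + |q|) * ((a + 1 / 2 + n) * (a + k + 1 / 2 + n)) := by
    have h1 : ((n : ℝ) + 1) ^ 2 ≤ (a + 1 / 2 + n) * (a + k + 1 / 2 + n) := by
      rw [sq]
      exact mul_le_mul (by linarith) (by linarith) (by linarith) (by linarith)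
    refine le_trans ?_ (mul_le_mul_of_nonneg_left h1 (by positivity))
    refine (abs_add_three _ _ _).trans ?_
    rw [abs_of_nonneg (sq_nonneg (n : ℝ)), abs_mul, abs_of_nonneg hn]
    have := mul_nonneg (abs_nonneg p) (by positivity : 0 ≤ (n : ℝ) ^ 2 + n + 1)
    have := mul_nonneg (abs_nonneg q) (by positivity : 0 ≤ (n : ℝ) ^ 2 + 2 * n)
    nlinarith
  rw [dixonCertificate, ← hp, ← hq, Real.norm_eq_abs, abs_mul, abs_neg, abs_div, abs_mul,
    abs_of_nonneg hn, abs_of_nonneg (by positivity :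
      0 ≤ (a + 2 * k) * (a + 1 / 2 + n) * (a + k + 1 / 2 + n))]
  calc _ ≤ n * ((1 + |p| + |q|) * ((a + 1 / 2 + n) * (a + k + 1 / 2 + n))) /
          ((a + 2 * k) * (a + 1 / 2 + n) * (a + k + 1 / 2 + n)) *
          (centralRatio n * ((k + 1 / 2) / (k + 1 / 2 + n))) := by
        gcongr
        exact abs_dixonTerm_le hk ha n
    _ = (1 + |p| + |q|) * (k + 1 / 2) / (a + 2 * k) * centralRatio n * (n / (k + 1 / 2 + n)) := by
        field_simp
    _ ≤ _ := mul_le_of_le_one_right (by positivity)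
        ((div_le_one (by positivity)).mpr (by linarith))

theorem tendsto_prod_range_of_tendsto_zero {f : ℕ → ℕ → ℝ}
    (hf : ∀ i, Tendsto (fun j => f j i) atTop (𝓝 0)) (n : ℕ) :
    Tendsto (fun j => ∏ i ∈ Finset.range n, f j i) atTop (𝓝 (if n = 0 then 1 else 0)) := by
  have h := tendsto_finsetProd (Finset.range n) fun i _ => hf i
  rwa [Finset.prod_const, Finset.card_range, zero_pow_eq] at h

theorem tendsto_gaussTerm (k c : ℝ) (n : ℕ) :
    Tendsto (fun j : ℕ => gaussTerm k (c + j) n) atTop (𝓝 (if n = 0 then 1 else 0)) := by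
  refine tendsto_prod_range_of_tendsto_zero
    (f := fun j i => ((1 / 2 + i) * (1 / 2 - k + i)) / ((c + j + i) * (i + 1))) (fun i => ?_) n
  refine Tendsto.div_atTop tendsto_const_nhds ?_
  exact ((tendsto_atTop_add_const_right _ _ (tendsto_atTop_add_const_left _ _
    tendsto_natCast_atTop_atTop)).atTop_mul_const (by positivity))

theorem tendsto_dixonTerm {k a : ℝ} (hk : 0 ≤ k) (ha : 0 < a) (n : ℕ) :
    Tendsto (fun j : ℕ => dixonTerm k (a + 2 * j) n) atTop (𝓝 (if n = 0 then 1 else 0)) := by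
  refine tendsto_prod_range_of_tendsto_zero
    (f := fun j i => ((a + 2 * j + i) * (1 / 2 + i) * (1 / 2 - k + i)) /
    ((a + 2 * j + 1 / 2 + i) * (a + 2 * j + k + 1 / 2 + i) * (i + 1))) (fun i => ?_) n
  have h : Tendsto (fun j : ℕ => ((1 / 2 + (i : ℝ)) * |1 / 2 - k + i|) /
      ((a + 2 * j + k + 1 / 2 + i) * (i + 1))) atTop (𝓝 0) := by
    refine Tendsto.div_atTop tendsto_const_nhds ?_
    refine Tendsto.atTop_mul_const (by positivity) ?_
    refine tendsto_atTop_mono (fun j => ?_) (tendsto_natCast_atTop_atTop (R := ℝ))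
    have : (0 : ℝ) ≤ j := Nat.cast_nonneg j
    have : (0 : ℝ) ≤ i := Nat.cast_nonneg i
    linarith
  refine squeeze_zero_norm (fun j => ?_) h
  have h1 : (a + 2 * j + i) / (a + 2 * j + 1 / 2 + i) ≤ 1 :=
    (div_le_one (by positivity)).mpr (by linarith)
  rw [norm_div, norm_mul, Real.norm_eq_abs, Real.norm_eq_abs, Real.norm_eq_abs,
    abs_of_nonneg (by positivity : 0 ≤ (a + 2 * j + i) * (1 / 2 + (i : ℝ))),
    abs_of_nonneg (by positivity : 0 ≤
      (a + 2 * j + 1 / 2 + i) * (a + 2 * j + k + 1 / 2 + i) * ((i : ℝ) + 1))]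
  calc _ = (a + 2 * j + i) / (a + 2 * j + 1 / 2 + i) * (((1 / 2 + (i : ℝ)) * |1 / 2 - k + i|) /
      ((a + 2 * j + k + 1 / 2 + i) * (i + 1))) := by field_simp
    _ ≤ _ := mul_le_of_le_one_left (by positivity) h1

/-! ### The Gauss and Dixon sums -/

theorem hasSum_gaussTerm {k : ℝ} (hk : 1 ≤ k) :
    HasSum (gaussTerm k (k + 1)) (Real.Gamma (k + 1) * Real.Gamma (2 * k) /
      (Real.Gamma (k + 1 / 2) * Real.Gamma (2 * k + 1 / 2))) := by
  have hprod := tendsto_prod_ratio_Gamma ![k + 1 / 2, 2 * k + 1 / 2] ![k + 1, 2 * k]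
    (by intro i; fin_cases i <;> simp <;> positivity)
    (by intro i; fin_cases i <;> simp <;> positivity)
    (by simp [Fin.sum_univ_succ]; ring)
  have hc : ∀ j : ℕ, k + 1 ≤ k + 1 + (j : ℝ) := fun j => by simp
  have h := hasSum_of_telescoping_recurrence
    (F := fun j n => gaussTerm k (k + 1 + j) n) (G := fun j n => gaussCertificate k (k + 1 + j) n)
    (R := fun j => ∏ i, ((![k + 1 / 2, 2 * k + 1 / 2] i + j) / (![k + 1, 2 * k] i + j)))
    (summable_centralRatio_mul (by linarith : (1 / 2 : ℝ) ≤ k - 1 / 2))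
    (fun j n => abs_gaussTerm_le hk (hc j) n) (fun n => tendsto_gaussTerm k _ n)
    (fun j n => ?_) (fun j => by simp [gaussCertificate])
    (fun j => tendsto_gaussCertificate hk (hc j)) hprod
  · convert h using 1
    · simp
    · simp [Fin.prod_univ_succ]
  · rw [← gaussTerm_sub hk (by positivity)]
    simp only [Fin.prod_univ_two, Matrix.cons_val_zero, Matrix.cons_val_one, Nat.cast_add,
      Nat.cast_one, ← add_assoc]
    have h1 : 2 * k + j ≠ 0 := by positivity
    have h2 : k + 1 + j ≠ 0 := by positivity
    rw [show k + 1 + (j : ℝ) - 1 / 2 = k + 1 / 2 + j by ring,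
      show k + 1 + (j : ℝ) + k - 1 / 2 = 2 * k + 1 / 2 + j by ring,
      show k + 1 + (j : ℝ) + k - 1 = 2 * k + j by ring, div_mul_div_comm]

theorem hasSum_dixonTerm {k : ℝ} (hk : 0 ≤ k) :
    HasSum (dixonTerm k (1 / 2))
      (Real.Gamma (k + 1 / 4) * Real.Gamma (1 / 2) * Real.Gamma (k / 2 + 1 / 2) *
        Real.Gamma (k / 2 + 1) / (Real.Gamma (3 / 4) ^ 2 * Real.Gamma (k / 2 + 1 / 4) *
        Real.Gamma (k / 2 + 3 / 4) * Real.Gamma (k + 3 / 4))) := by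
  -- The parameters come from the shift factor at a = 1/2 + 2j, each linear factor being a constant
  -- multiple of j plus a constant. The entry 1 comes from a + 3/2 = 2(1 + j) and contributes Γ(1) =
  -- 1.
  have hprod := tendsto_prod_ratio_Gamma
    ![3 / 4, 3 / 4, k / 2 + 1 / 4, k / 2 + 3 / 4, k + 3 / 4]
    ![k + 1 / 4, 1 / 2, k / 2 + 1 / 2, k / 2 + 1, 1]
    (by intro i; fin_cases i <;> simp <;> positivity)
    (by intro i; fin_cases i <;> simp <;> positivity)
    (by simp [Fin.sum_univ_succ]; ring)
  have ha : ∀ j : ℕ, (1 / 2 : ℝ) ≤ 1 / 2 + 2 * (j : ℝ) := fun j => by simp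
  have h := hasSum_of_telescoping_recurrence
    (F := fun j n => dixonTerm k (1 / 2 + 2 * j) n)
    (G := fun j n => dixonCertificate k (1 / 2 + 2 * j) n)
    (R := fun j => ∏ i, ((![3 / 4, 3 / 4, k / 2 + 1 / 4, k / 2 + 3 / 4, k + 3 / 4] i + j) /
      (![k + 1 / 4, 1 / 2, k / 2 + 1 / 2, k / 2 + 1, 1] i + j)))
    (summable_centralRatio_mul (by linarith : (1 / 2 : ℝ) ≤ k + 1 / 2))
    (fun j n => abs_dixonTerm_le hk (ha j) n)
    (fun n => tendsto_dixonTerm hk (by norm_num) n)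
    (fun j n => ?_) (fun j => by simp [dixonCertificate])
    (fun j => tendsto_dixonCertificate hk (ha j)) hprod
  · convert h using 1
    · simp
    · simp [Fin.prod_univ_succ]
      ring
  · rw [← dixonTerm_sub hk (by positivity), Nat.cast_succ, mul_add, mul_one, ← add_assoc]
    congr 2
    simp only [Fin.prod_univ_five, Matrix.cons_val]
    rw [show 1 / 2 + 2 * (j : ℝ) + 2 * k = 2 * (k + 1 / 4 + j) by ring,
      show 1 / 2 + 2 * (j : ℝ) + 1 / 2 = 2 * (1 / 2 + j) by ring,
      show 1 / 2 + 2 * (j : ℝ) + 3 / 2 = 2 * (1 + j) by ring,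
      show 1 / 2 + 2 * (j : ℝ) + k + 1 / 2 = 2 * (k / 2 + 1 / 2 + j) by ring,
      show 1 / 2 + 2 * (j : ℝ) + k + 3 / 2 = 2 * (k / 2 + 1 + j) by ring,
      show 1 + (1 / 2 + 2 * (j : ℝ)) = 2 * (3 / 4 + j) by ring,
      show 1 / 2 + 2 * (j : ℝ) + k = 2 * (k / 2 + 1 / 4 + j) by ring,
      show 2 * (3 / 4 + (j : ℝ)) + k = 2 * (k / 2 + 3 / 4 + j) by ring,
      show (1 / 2 + 2 * (j : ℝ)) / 2 + 1 / 2 = 3 / 4 + j by ring,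
      show 3 / 4 + (j : ℝ) + k = k + 3 / 4 + j by ring]
    have h1 : k + 1 / 4 + (j : ℝ) ≠ 0 := by positivity
    have h2 : 1 / 2 + (j : ℝ) ≠ 0 := by positivity
    have h3 : 1 + (j : ℝ) ≠ 0 := by positivity
    have h4 : k / 2 + 1 / 2 + (j : ℝ) ≠ 0 := by positivity
    have h5 : k / 2 + 1 + (j : ℝ) ≠ 0 := by positivity
    generalize k + 1 / 4 + (j : ℝ) = y₁ at *
    generalize 1 / 2 + (j : ℝ) = y₂ at *
    generalize 1 + (j : ℝ) = y₃ at *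
    generalize k / 2 + 1 / 2 + (j : ℝ) = y₄ at *
    generalize k / 2 + 1 + (j : ℝ) = y₅ at *
    field_simp
    ring

theorem HasSum.of_eq {f g : ℕ → ℝ} {a b : ℝ} (h : HasSum f a) (hfg : ∀ n, g n = f n)
    (hab : b = a) : HasSum g b := by
  rwa [funext hfg, hab]

/-! ### Rising factorials and the paired denominator -/

theorem risingFactorial_succ (a : ℝ) (k : ℕ) :
    risingFactorial a (k + 1) = risingFactorial a k * (a + k) :=
  ascPochhammer_succ_eval k a

theorem risingFactorial_add_one_mul (a : ℝ) (k : ℕ) :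
    risingFactorial (a + 1) k * a = risingFactorial a k * (a + k) := by
  rw [← risingFactorial_succ, risingFactorial, risingFactorial, ascPochhammer_succ_left,
    Polynomial.eval_mul, Polynomial.eval_X, Polynomial.eval_comp]
  simp [mul_comm]

theorem Gamma_add_natCast {x : ℝ} (hx : 0 < x) (k : ℕ) :
    Real.Gamma (k + x) = risingFactorial x k * Real.Gamma x := by
  induction k with
  | zero => simp [risingFactorial]
  | succ k ih =>
    have h : ((k + 1 : ℕ) : ℝ) + x = (k + x) + 1 := by push_cast; ring
    rw [h, Real.Gamma_add_one (by positivity), ih, risingFactorial_succ]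
    ring

theorem risingFactorial_pos {x : ℝ} (hx : 0 < x) (k : ℕ) : 0 < risingFactorial x k :=
  ascPochhammer_pos k x hx

theorem risingFactorial_ratCast (x : ℚ) (k : ℕ) :
    risingFactorial (x : ℝ) k = ((ascPochhammer ℚ k).eval x : ℚ) := by
  rw [risingFactorial, ← ascPochhammer_map (algebraMap ℚ ℝ),
    ← eq_ratCast (algebraMap ℚ ℝ) x, Polynomial.eval_map_apply]
  simp

/-- The denominator `(n + 1)_k (1 / 2 - n)_k`. -/
noncomputable def pairDenominator (k n : ℕ) : ℝ :=
  risingFactorial ((n : ℝ) + 1) k * risingFactorial (1 / 2 - (n : ℝ)) k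

theorem half_sub_natCast_ne_zero (n k : ℕ) : (1 / 2 - (n : ℝ) + k) ≠ 0 := by
  intro h
  have h1 : (2 * n : ℝ) = 1 + 2 * k := by linarith
  have h2 : 2 * n = 1 + 2 * k := by exact_mod_cast h1
  omega

/-- The new factors n+1+k and 1/2-n+k pair up into a function of n(n+1/2) alone. -/
theorem pairDenominator_succ_right (k n : ℕ) : pairDenominator (k + 1) n =
    pairDenominator k n * (((k : ℝ) + 1) * (k + 1 / 2) - n * (n + 1 / 2)) := by
  rw [pairDenominator, pairDenominator, risingFactorial_succ, risingFactorial_succ]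
  ring

theorem pairDenominator_ne_zero (k n : ℕ) : pairDenominator k n ≠ 0 := by
  refine mul_ne_zero (risingFactorial_pos (by positivity) k).ne' ?_
  induction k with
  | zero => simp [risingFactorial]
  | succ k ih => rw [risingFactorial_succ]; exact mul_ne_zero ih (half_sub_natCast_ne_zero n k)

theorem pairDenominator_succ_mul (k n : ℕ) :
    pairDenominator k (n + 1) * ((n + 1) * (1 / 2 - k + n)) =
      pairDenominator k n * ((n + 1 + k) * (1 / 2 + n)) := by
  have h1 := risingFactorial_add_one_mul ((n : ℝ) + 1) k
  have h2 := risingFactorial_add_one_mul (1 / 2 - ((n : ℝ) + 1)) k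
  rw [show 1 / 2 - ((n : ℝ) + 1) + 1 = 1 / 2 - n by ring] at h2
  simp only [pairDenominator]
  push_cast
  linear_combination risingFactorial (1 / 2 - ((n : ℝ) + 1)) k * (1 / 2 - k + n) * h1
    + risingFactorial ((n : ℝ) + 1) k * (n + 1 + k) * h2

theorem one_div_pairDenominator_succ (k n : ℕ) :
    1 / pairDenominator k (n + 1) =
      1 / pairDenominator k n * (((n + 1) * (1 / 2 - k + n)) / ((n + 1 + k) * (1 / 2 + n))) := by
  have h := pairDenominator_succ_mul k n
  have h0 := pairDenominator_ne_zero k n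
  have h1 := pairDenominator_ne_zero k (n + 1)
  rw [div_mul_div_comm, div_eq_div_iff h1 (by positivity)]
  linear_combination -h

/-- Both sides have the same term ratio: at a = 1/2 the lower parameters of the Dixon series are 1
and k+1. -/
theorem centralRatio_cube_div (k n : ℕ) :
    centralRatio n ^ 3 / pairDenominator k n =
      1 / pairDenominator k 0 * dixonTerm k (1 / 2) n := by
  induction n with
  | zero => simp [centralRatio_zero, dixonTerm]
  | succ n ih =>
    rw [dixonTerm_succ, ← mul_assoc, ← ih, ← mul_one_div, one_div_pairDenominator_succ,
      centralRatio_succ]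
    have h0 := pairDenominator_ne_zero k n
    rw [show (1 / 2 : ℝ) + 1 / 2 + n = n + 1 by ring,
      show (1 / 2 : ℝ) + k + 1 / 2 + n = n + 1 + k by ring]
    field_simp

theorem centralRatio_sq_div (k n : ℕ) :
    centralRatio n ^ 2 / pairDenominator k n =
      1 / pairDenominator k 0 * gaussTerm k (k + 1) n := by
  induction n with
  | zero => simp [centralRatio_zero, gaussTerm]
  | succ n ih =>
    rw [gaussTerm_succ, ← mul_assoc, ← ih, ← mul_one_div, one_div_pairDenominator_succ,
      centralRatio_succ]
    have h0 := pairDenominator_ne_zero k n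
    rw [show (k : ℝ) + 1 + n = n + 1 + k by ring]
    field_simp

theorem pairDenominator_zero_right (k : ℕ) :
    pairDenominator k 0 = Real.Gamma (k + 1) * Real.Gamma (k + 1 / 2) / √Real.pi := by
  rw [Gamma_add_natCast one_pos, Gamma_add_natCast one_half_pos, Real.Gamma_one_half_eq,
    pairDenominator]
  have : √Real.pi ≠ 0 := (Real.sqrt_pos.mpr Real.pi_pos).ne'
  simp
  field_simp

theorem Gamma_quarter_mul_Gamma_three_quarters :
    Real.Gamma (1 / 4) * Real.Gamma (3 / 4) = Real.pi * √2 := by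
  have h := Real.Gamma_mul_Gamma_one_sub (1 / 4)
  rw [show (1 : ℝ) - 1 / 4 = 3 / 4 by norm_num, mul_one_div, Real.sin_pi_div_four] at h
  rw [h]
  have : √2 ≠ (0 : ℝ) := by positivity
  field_simp
  norm_num

/-! ### Closed forms of the two series -/

theorem hasSum_centralRatio_cube_div (k : ℕ) :
    HasSum (fun n => centralRatio n ^ 3 / pairDenominator k n)
      (Real.Gamma (1 / 4) ^ 2 / (2 * Real.pi * √2) *
        (Real.Gamma (k + 1 / 4) / (Real.Gamma (k + 1 / 2) ^ 2 * Real.Gamma (k + 3 / 4)))) := by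
  simp only [centralRatio_cube_div]
  have h := (hasSum_dixonTerm (Nat.cast_nonneg k : (0 : ℝ) ≤ k)).mul_left (1 / pairDenominator k 0)
  refine h.of_eq (fun _ => rfl) ?_
  -- Duplication merges the four Gamma values at k/2 + const into Γ(k+1) and Γ(k+1/2); reflection
  -- then removes Γ(3/4).
  have d1 := Real.Gamma_mul_Gamma_add_half_of_pos (by positivity : 0 < (k : ℝ) / 2 + 1 / 2)
  have d2 := Real.Gamma_mul_Gamma_add_half_of_pos (by positivity : 0 < (k : ℝ) / 2 + 1 / 4)
  rw [show (k : ℝ) / 2 + 1 / 2 + 1 / 2 = k / 2 + 1 by ring,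
    show 2 * ((k : ℝ) / 2 + 1 / 2) = k + 1 by ring, show 1 - ((k : ℝ) + 1) = -k by ring] at d1
  rw [show (k : ℝ) / 2 + 1 / 4 + 1 / 2 = k / 2 + 3 / 4 by ring,
    show 2 * ((k : ℝ) / 2 + 1 / 4) = k + 1 / 2 by ring,
    show 1 - ((k : ℝ) + 1 / 2) = -k + 1 / 2 by ring, Real.rpow_add two_pos,
    ← Real.sqrt_eq_rpow] at d2
  have q := Gamma_quarter_mul_Gamma_three_quarters
  rw [pairDenominator_zero_right, Real.Gamma_one_half_eq,
    mul_assoc _ (Real.Gamma (k / 2 + 1 / 2)), d1, mul_assoc _ (Real.Gamma (k / 2 + 1 / 4)), d2]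
  have g1 : Real.Gamma (1 / 4) ≠ 0 := (Real.Gamma_pos_of_pos (by norm_num)).ne'
  have g2 : Real.Gamma (3 / 4) ≠ 0 := (Real.Gamma_pos_of_pos (by norm_num)).ne'
  have g3 : Real.Gamma (k + 1 / 4) ≠ 0 := (Real.Gamma_pos_of_pos (by positivity)).ne'
  have g4 : Real.Gamma (k + 1 / 2) ≠ 0 := (Real.Gamma_pos_of_pos (by positivity)).ne'
  have g5 : Real.Gamma (k + 3 / 4) ≠ 0 := (Real.Gamma_pos_of_pos (by positivity)).ne'
  have g6 : Real.Gamma (k + 1) ≠ 0 := (Real.Gamma_pos_of_pos (by positivity)).ne'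
  have g7 : (2 : ℝ) ^ (-(k : ℝ)) ≠ 0 := (Real.rpow_pos_of_pos two_pos _).ne'
  have g8 : √Real.pi ≠ 0 := (Real.sqrt_pos.mpr Real.pi_pos).ne'
  have g9 : √2 ≠ (0 : ℝ) := by positivity
  have g10 := Real.pi_pos.ne'
  have hpi : √Real.pi ^ 2 = Real.pi := Real.sq_sqrt Real.pi_pos.le
  have h2 : √2 ^ 2 = (2 : ℝ) := Real.sq_sqrt zero_le_two
  have q' : Real.Gamma (3 / 4) = Real.pi * √2 / Real.Gamma (1 / 4) := by
    rw [← q]; field_simp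
  rw [q']
  generalize √Real.pi = s at *
  rw [← hpi]
  field_simp
  rw [h2]

theorem hasSum_centralRatio_sq_div {k : ℕ} (hk : 1 ≤ k) :
    HasSum (fun n => centralRatio n ^ 2 / pairDenominator k n)
      (2 ^ (8 * k - 3) * Real.Gamma k ^ 2 / (Real.pi * Real.Gamma (4 * k))) := by
  simp only [centralRatio_sq_div]
  have hk' : (1 : ℝ) ≤ k := by exact_mod_cast hk
  have h := (hasSum_gaussTerm hk').mul_left (1 / pairDenominator k 0)
  refine h.of_eq (fun _ => rfl) ?_
  have hk0 : (0 : ℝ) < k := by linarith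
  -- Duplication at k and at 2k expresses everything through Γ(k), Γ(2k), Γ(4k); Γ(2k) then cancels.
  have d1 := Real.Gamma_mul_Gamma_add_half_of_pos hk0
  have d2 := Real.Gamma_mul_Gamma_add_half_of_pos (by positivity : 0 < 2 * (k : ℝ))
  rw [show 2 * (2 * (k : ℝ)) = 4 * k by ring] at d2
  have g1 : Real.Gamma k ≠ 0 := (Real.Gamma_pos_of_pos hk0).ne'
  have g2 : Real.Gamma (2 * k) ≠ 0 := (Real.Gamma_pos_of_pos (by positivity)).ne'
  have g3 : Real.Gamma (4 * k) ≠ 0 := (Real.Gamma_pos_of_pos (by positivity)).ne'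
  have g4 : Real.Gamma (k + 1) ≠ 0 := (Real.Gamma_pos_of_pos (by positivity)).ne'
  have g8 : √Real.pi ≠ 0 := (Real.sqrt_pos.mpr Real.pi_pos).ne'
  have hpi : √Real.pi ^ 2 = Real.pi := Real.sq_sqrt Real.pi_pos.le
  have e1 : Real.Gamma (k + 1 / 2) =
      Real.Gamma (2 * k) * 2 ^ (1 - 2 * (k : ℝ)) * √Real.pi / Real.Gamma k := by
    rw [← d1]; field_simp
  have e2 : Real.Gamma (2 * k + 1 / 2) =
      Real.Gamma (4 * k) * 2 ^ (1 - 4 * (k : ℝ)) * √Real.pi / Real.Gamma (2 * k) := by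
    rw [← d2]; field_simp
  have hp : (2 : ℝ) ^ (8 * k - 3) * ((2 ^ (1 - 2 * (k : ℝ))) ^ 2 * 2 ^ (1 - 4 * (k : ℝ))) = 1 := by
    rw [← Real.rpow_natCast, ← Real.rpow_natCast, ← Real.rpow_mul zero_le_two,
      ← Real.rpow_add two_pos, ← Real.rpow_add two_pos, Nat.cast_sub (by omega)]
    push_cast
    ring_nf
    exact Real.rpow_zero 2
  have g5 : (2 : ℝ) ^ (1 - 2 * (k : ℝ)) ≠ 0 := (Real.rpow_pos_of_pos two_pos _).ne'
  have g6 : (2 : ℝ) ^ (1 - 4 * (k : ℝ)) ≠ 0 := (Real.rpow_pos_of_pos two_pos _).ne'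
  rw [pairDenominator_zero_right, e1, e2]
  generalize (2 : ℝ) ^ (1 - 2 * (k : ℝ)) = x at *
  generalize (2 : ℝ) ^ (1 - 4 * (k : ℝ)) = y at *
  generalize √Real.pi = s at *
  rw [← hpi]
  field_simp
  linear_combination hp

/-! ### Rational multiples for admissible polynomials -/

-- Partial fractions in t = n(n+1/2): with y the zero of the last factor of P_{M+1} and N = N(y) +
-- (t-y)N', one has N/P_{M+1} = N(y)/P_{M+1} - N'/P_M. The degree condition keeps every index at
-- least `k₀`; it is waived for N = 0 because N' vanishes once N is constant.
open Polynomial in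
theorem exists_rat_hasSum_polynomial_div {w : ℕ → ℝ} {c : ℝ} {k₀ : ℕ}
    (h : ∀ k, k₀ ≤ k → ∃ q : ℚ, HasSum (fun n => w n / pairDenominator k n) (q * c)) (M : ℕ) :
    ∀ N : ℚ[X], (N ≠ 0 → N.natDegree + k₀ ≤ M) →
      ∃ q : ℚ, HasSum (fun n : ℕ => w n / pairDenominator M n *
        aeval ((n : ℝ) * (n + 1 / 2)) N) (q * c) := by
  induction M with
  | zero =>
    intro N hN
    by_cases h0 : N = 0
    · exact ⟨0, by simp [h0, hasSum_zero]⟩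
    · have := hN h0
      obtain ⟨q, hq⟩ := h 0 (by omega)
      obtain ⟨r, rfl⟩ := natDegree_eq_zero.mp (by omega : N.natDegree = 0)
      refine ⟨q * r, ?_⟩
      refine (hq.mul_right (r : ℝ)).of_eq (fun n => ?_) ?_
      · simp
      · push_cast; ring
  | succ M ih =>
    intro N hN
    by_cases h0 : N = 0
    · exact ⟨0, by simp [h0, hasSum_zero]⟩
    have hdeg := hN h0
    set y : ℚ := ((M : ℚ) + 1) * (M + 1 / 2) with hy
    set N' := N /ₘ (X - C y) with hN'
    have hdec : N = C (N.eval y) + (X - C y) * N' := by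
      conv_lhs => rw [← modByMonic_add_div N (X - C y), modByMonic_X_sub_C_eq_C_eval]
    obtain ⟨q, hq⟩ := h (M + 1) (by omega)
    obtain ⟨q', hq'⟩ := ih N' (fun hne => by
      have h1 : N'.natDegree = N.natDegree - 1 := by
        rw [hN', natDegree_divByMonic _ (monic_X_sub_C y), natDegree_X_sub_C]
      have h2 : N.natDegree ≠ 0 := fun h2 => hne <| by
        rw [hN', divByMonic_eq_zero_iff (monic_X_sub_C y), degree_X_sub_C]
        exact natDegree_pos_iff_degree_pos.not.mp (by omega) |> fun h3 =>
          lt_of_le_of_lt (not_lt.mp h3) zero_lt_one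
      omega)
    refine ⟨N.eval y * q - q', ?_⟩
    refine ((hq.mul_left ((N.eval y : ℚ) : ℝ)).sub hq').of_eq (fun n => ?_) ?_
    · have hd := pairDenominator_ne_zero M n
      have hd1 := pairDenominator_ne_zero (M + 1) n
      have hs := pairDenominator_succ_right M n
      conv_lhs => rw [hdec]
      simp only [map_add, map_mul, map_sub, aeval_X, aeval_C, eq_ratCast]
      have hyr : ((y : ℚ) : ℝ) = ((M : ℝ) + 1) * (M + 1 / 2) := by rw [hy]; push_cast; ring
      rw [hyr]
      field_simp
      rw [hs]
      ring
    · push_cast; ring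

theorem exists_rat_hasSum_cube (k : ℕ) :
    ∃ q : ℚ, HasSum (fun n => centralRatio n ^ 3 / pairDenominator k n)
      (q * (Real.Gamma (1 / 4) ^ 4 / (8 * Real.pi ^ 3))) := by
  -- The leading 2 arises since Γ(1/4)^3 / (2√2 π^2 Γ(3/4)) equals Γ(1/4)^4 / (4π^3) by reflection.
  refine ⟨2 * (ascPochhammer ℚ k).eval (1 / 4) / (((ascPochhammer ℚ k).eval (1 / 2)) ^ 2 *
    (ascPochhammer ℚ k).eval (3 / 4)), ?_⟩
  refine (hasSum_centralRatio_cube_div k).of_eq (fun _ => rfl) ?_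
  rw [Gamma_add_natCast (by norm_num), Gamma_add_natCast (by norm_num),
    Gamma_add_natCast (by norm_num), Real.Gamma_one_half_eq]
  have r1 := risingFactorial_ratCast (1 / 4) k
  have r2 := risingFactorial_ratCast (1 / 2) k
  have r3 := risingFactorial_ratCast (3 / 4) k
  push_cast at r1 r2 r3 ⊢
  rw [← r1, ← r2, ← r3]
  have p2 := (risingFactorial_pos (by norm_num : (0 : ℝ) < 1 / 2) k).ne'
  have p3 := (risingFactorial_pos (by norm_num : (0 : ℝ) < 3 / 4) k).ne'
  have q := Gamma_quarter_mul_Gamma_three_quarters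
  have g1 : Real.Gamma (1 / 4) ≠ 0 := (Real.Gamma_pos_of_pos (by norm_num)).ne'
  have q' : Real.Gamma (3 / 4) = Real.pi * √2 / Real.Gamma (1 / 4) := by
    rw [← q]; field_simp
  have hpi : √Real.pi ^ 2 = Real.pi := Real.sq_sqrt Real.pi_pos.le
  have h2 : √2 ^ 2 = (2 : ℝ) := Real.sq_sqrt zero_le_two
  have hpi0 := Real.pi_pos.ne'
  rw [q', mul_pow _ (√Real.pi), hpi]
  field_simp
  rw [h2]
  ring

theorem exists_rat_hasSum_sq (k : ℕ) (hk : 1 ≤ k) :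
    ∃ q : ℚ, HasSum (fun n => centralRatio n ^ 2 / pairDenominator k n)
      (q * (1 / Real.pi)) := by
  refine ⟨2 ^ (8 * k - 3) * ((k - 1).factorial : ℚ) ^ 2 / ((4 * k - 1).factorial : ℚ), ?_⟩
  refine (hasSum_centralRatio_sq_div hk).of_eq (fun _ => rfl) ?_
  obtain ⟨m, rfl⟩ := Nat.exists_eq_add_of_le' hk
  have e : 4 * ((m + 1 : ℕ) : ℝ) = ((4 * m + 3 : ℕ) : ℝ) + 1 := by push_cast; ring
  rw [e, Real.Gamma_nat_eq_factorial, Nat.cast_succ, Real.Gamma_nat_eq_factorial,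
    show 4 * (m + 1) - 1 = 4 * m + 3 by omega, Nat.add_sub_cancel]
  push_cast
  have := Real.pi_pos.ne'
  field_simp

-- The symmetry x ↦ -1/2-x exchanges the roots -(m+1) and m+1/2, so the simple roots come in such
-- pairs, and each pair contributes (n+m+1)(n-m-1/2) = n(n+1/2) - (m+1)(m+1/2).
open Polynomial in
theorem IsAdmissible.exists_eval_eq {p : ℚ[X]} (hp : IsAdmissible p) :
    ∃ S : Finset ℕ, (0 < p.natDegree → S.Nonempty) ∧ ∀ n : ℕ, aeval (n : ℝ) p =
      (p.leadingCoeff : ℝ) *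
        ∏ m ∈ S, ((n : ℝ) * (n + 1 / 2) - ((m : ℝ) + 1) * (m + 1 / 2)) := by
  classical
  set Z : Finset ℂ := (p.aroots ℂ).toFinset with hZ
  have hmem : ∀ z, z ∈ Z ↔ aeval z p = 0 := fun z => by
    rw [hZ, Multiset.mem_toFinset, mem_aroots]
    exact and_iff_right hp.ne_zero
  have hsymm : ∀ z : ℂ, aeval (-1 / 2 - z) p = aeval z p := fun z => by
    conv_rhs => rw [← hp.symmetric]
    rw [aeval_comp]
    simp
  have hinj1 : Function.Injective fun m : ℕ => (-((m : ℂ) + 1)) := fun a b h => by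
    simpa using h
  have hinj2 : Function.Injective fun m : ℕ => ((m : ℂ) + 1 / 2) := fun a b h => by
    simpa using h
  have hpair : ∀ m : ℕ, (-((m : ℂ) + 1)) ∈ Z ↔ ((m : ℂ) + 1 / 2) ∈ Z := fun m => by
    rw [hmem, hmem, ← hsymm]
    ring_nf
  set S : Finset ℕ := Z.preimage (fun m : ℕ => (-((m : ℂ) + 1))) hinj1.injOn with hS
  have hZS : Z = S.image (fun m : ℕ => (-((m : ℂ) + 1))) ∪
      S.image fun m : ℕ => ((m : ℂ) + 1 / 2) := by
    ext z
    simp only [Finset.mem_union, Finset.mem_image, hS, Finset.mem_preimage]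
    constructor
    · intro hz
      obtain ⟨m, rfl⟩ | ⟨m, rfl⟩ := hp.roots_mem z (Multiset.mem_toFinset.mp hz)
      · exact Or.inl ⟨m, hz, rfl⟩
      · exact Or.inr ⟨m, (hpair m).mpr hz, rfl⟩
    · rintro (⟨m, hm, rfl⟩ | ⟨m, hm, rfl⟩)
      · exact hm
      · exact (hpair m).mp hm
  have hdisj : Disjoint (S.image (fun m : ℕ => (-((m : ℂ) + 1))))
      (S.image fun m : ℕ => ((m : ℂ) + 1 / 2)) := by
    rw [Finset.disjoint_left]
    simp only [Finset.mem_image, not_exists, not_and]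
    -- The two families of roots have real parts of opposite sign.
    rintro _ ⟨a, -, rfl⟩ b - h
    have h' := congrArg Complex.re h
    simp at h'
    have : (0 : ℝ) ≤ a := Nat.cast_nonneg a
    have : (0 : ℝ) ≤ b := Nat.cast_nonneg b
    norm_num at h'
    linarith
  have hsplit : (p.map (algebraMap ℚ ℂ)).Splits := IsAlgClosed.splits _
  refine ⟨S, fun hdeg => ?_, fun n => ?_⟩
  · have hcard := hsplit.natDegree_eq_card_roots
    rw [natDegree_map] at hcard
    by_contra hne
    rw [Finset.not_nonempty_iff_eq_empty] at hne
    rw [hne] at hZS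
    simp only [Finset.image_empty, Finset.union_empty] at hZS
    have : p.aroots ℂ = 0 := by rwa [hZ, Multiset.toFinset_eq_empty] at hZS
    rw [aroots] at this
    simp [this] at hcard
    omega
  · have hev := hsplit.eval_eq_prod_roots (n : ℂ)
    have hroots : ((p.map (algebraMap ℚ ℂ)).roots.map fun z => (n : ℂ) - z).prod =
        ∏ z ∈ Z, ((n : ℂ) - z) := by
      rw [Finset.prod, hZ, Multiset.toFinset_val, hp.simple_roots.dedup]
    rw [hroots, hZS, Finset.prod_union hdisj, Finset.prod_image hinj1.injOn,
      Finset.prod_image hinj2.injOn, ← Finset.prod_mul_distrib, leadingCoeff_map] at hev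
    have hre : ((aeval (n : ℝ) p : ℝ) : ℂ) = (p.map (algebraMap ℚ ℂ)).eval (n : ℂ) := by
      rw [eval_map_algebraMap, ← Complex.coe_algebraMap, ← aeval_algebraMap_apply]
      simp
    apply Complex.ofReal_injective
    rw [hre, hev]
    push_cast
    rw [eq_ratCast]
    congr 1
    refine Finset.prod_congr rfl fun m _ => ?_
    ring

open Polynomial in
theorem IsAdmissible.exists_rat_hasSum {p : ℚ[X]} (hp : IsAdmissible p) {w : ℕ → ℝ} {c : ℝ}
    {k₀ : ℕ} (hk₀ : k₀ = 0 ∨ k₀ = 1 ∧ 0 < p.natDegree)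
    (h : ∀ k, k₀ ≤ k → ∃ q : ℚ, HasSum (fun n => w n / pairDenominator k n) (q * c)) :
    ∃ q : ℚ, HasSum (fun n : ℕ => 1 / aeval (n : ℝ) p * w n) (q * c) := by
  classical
  obtain ⟨S, hne, hS⟩ := hp.exists_eval_eq
  set M := S.sup id + 1 with hM
  have hsub : S ⊆ Finset.range M := fun m hm =>
    Finset.mem_range.mpr (Nat.lt_succ_of_le (Finset.le_sup (f := id) hm))
  -- N collects the factors of P_M that p lacks, so 1/p is N/P_M up to sign and leading coefficient.
  set N : ℚ[X] := ∏ m ∈ Finset.range M \ S, (C (((m : ℚ) + 1) * (m + 1 / 2)) - X) with hN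
  have hdeg : N.natDegree ≤ (Finset.range M \ S).card := by
    refine (natDegree_prod_le _ _).trans ?_
    refine (Finset.sum_le_card_nsmul _ _ 1 fun m _ => ?_).trans (by simp)
    compute_degree
  have hcard : (Finset.range M \ S).card + S.card = M := by
    rw [Finset.card_sdiff_add_card_eq_card hsub, Finset.card_range]
  -- Here deg N ≤ M - |S|. When `k₀` is 1, a nonconstant p makes S nonempty, which supplies the
  -- extra unit.
  obtain ⟨q, hq⟩ := exists_rat_hasSum_polynomial_div h M N (fun _ => by
    rcases hk₀ with rfl | ⟨rfl, hpos⟩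
    · omega
    · have := Finset.card_pos.mpr (hne hpos)
      omega)
  have hden : ∀ k n : ℕ, pairDenominator k n =
      ∏ m ∈ Finset.range k, (((m : ℝ) + 1) * (m + 1 / 2) - n * (n + 1 / 2)) := by
    intro k n
    induction k with
    | zero => simp [pairDenominator, risingFactorial]
    | succ k ih => rw [pairDenominator_succ_right, ih, Finset.prod_range_succ]
  refine ⟨(-1) ^ S.card / p.leadingCoeff * q, ?_⟩
  refine (hq.mul_left (((-1) ^ S.card / p.leadingCoeff : ℚ) : ℝ)).of_eq (fun n => ?_) ?_
  · have hd := pairDenominator_ne_zero M n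
    rw [hden, ← Finset.prod_sdiff hsub] at hd ⊢
    have hNn : aeval ((n : ℝ) * (n + 1 / 2)) N =
        ∏ m ∈ Finset.range M \ S, (((m : ℝ) + 1) * (m + 1 / 2) - n * (n + 1 / 2)) := by
      simp [hN, map_prod]
    have hneg : ∏ m ∈ S, ((n : ℝ) * (n + 1 / 2) - ((m : ℝ) + 1) * (m + 1 / 2)) =
        (-1) ^ S.card * ∏ m ∈ S, (((m : ℝ) + 1) * (m + 1 / 2) - n * (n + 1 / 2)) := by
      rw [← Finset.prod_const, ← Finset.prod_mul_distrib]
      exact Finset.prod_congr rfl fun m _ => by ring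
    rw [hS, hNn, hneg]
    obtain ⟨hd1, hd2⟩ := mul_ne_zero_iff.mp hd
    have hl : (p.leadingCoeff : ℝ) ≠ 0 := by
      exact_mod_cast leadingCoeff_ne_zero.mpr hp.ne_zero
    push_cast
    have hs : ((-1 : ℝ) ^ S.card) ^ 2 = 1 := by rw [← pow_mul, mul_comm, pow_mul]; simp
    have hs0 : ((-1 : ℝ) ^ S.card) ≠ 0 := by positivity
    generalize ((-1 : ℝ) ^ S.card) = s at *
    generalize ∏ m ∈ S, (((m : ℝ) + 1) * (m + 1 / 2) - n * (n + 1 / 2)) = A at *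
    generalize ∏ m ∈ Finset.range M \ S, (((m : ℝ) + 1) * (m + 1 / 2) - n * (n + 1 / 2)) = B at *
    field_simp
    rw [hs, one_mul]
  · push_cast; ring

theorem mainTheorem4 :
    (∀ k : ℕ, 1 ≤ k →
      HasSum
        (fun n : ℕ => centralRatio n ^ 3 /
          (risingFactorial ((n : ℝ) + 1) k * risingFactorial (1 / 2 - (n : ℝ)) k))
        (Real.Gamma (1 / 4) ^ 2 / (2 * Real.pi * Real.sqrt 2) *
          (Real.Gamma ((k : ℝ) + 1 / 4) /
            (Real.Gamma ((k : ℝ) + 1 / 2) ^ 2 * Real.Gamma ((k : ℝ) + 3 / 4)))) ∧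
      HasSum
        (fun n : ℕ => centralRatio n ^ 2 /
          (risingFactorial ((n : ℝ) + 1) k * risingFactorial (1 / 2 - (n : ℝ)) k))
        (2 ^ (8 * k - 3) * Real.Gamma (k : ℝ) ^ 2 / (Real.pi * Real.Gamma (4 * (k : ℝ))))) ∧
    (∀ p : Polynomial ℚ, IsAdmissible p →
      (∃ q : ℚ, HasSum
        (fun n : ℕ => 1 / (Polynomial.aeval (n : ℝ) p) * centralRatio n ^ 3)
        ((q : ℝ) * (Real.Gamma (1 / 4) ^ 4 / (8 * Real.pi ^ 3)))) ∧
      (0 < p.natDegree → ∃ q : ℚ, HasSum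
        (fun n : ℕ => 1 / (Polynomial.aeval (n : ℝ) p) * centralRatio n ^ 2)
        ((q : ℝ) * (1 / Real.pi)))) :=
  ⟨fun k hk => ⟨hasSum_centralRatio_cube_div k, hasSum_centralRatio_sq_div hk⟩, fun _ hp =>
    ⟨hp.exists_rat_hasSum (Or.inl rfl) fun k _ => exists_rat_hasSum_cube k, fun hdeg =>
      hp.exists_rat_hasSum (Or.inr ⟨rfl, hdeg⟩) exists_rat_hasSum_sq⟩⟩
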